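/- Conventions. Let $R$ be a commutative Noetherian ring and $M \neq 0$ a finitely generated $R$-module; $\dim_R N$ denotes the Krull dimension of $\mathrm{Supp}_R N$, with $\dim_R(0) = -\infty$. Let $$\mathcal{S}(M) = \{\dim_R N \mid N \text{ is a nonzero } R\text{-submodule of } M\} = \{d_1 < d_2 < \cdots < d_\ell\},$$ which is a finite set. The dimension filtration of $M$ is the chain $D_0 = (0) \subsetneq D_1 \subsetneq \cdots \subsetneq D_\ell = M$, where for $1 \le i \le \ell$ the submodule $D_i$ is the largest submodule of $M$ with $\dim_R D_i \le d_i$. The module $M$ is called sequentially Cohen-Macaulay if $D_i/D_{i-1}$ is a Cohen-Macaulay $R$-module for every $1 \le i \le \ell$. Here a finitely generated $R$-module $C$ is Cohen-Macaulay if $\mathrm{depth}_{R_P} C_P = \dim_{R_P} C_P$ for every maximal ideal $P \in \mathrm{Supp}_R C$. Statement. Let $R$ be a finitely generated commutative algebra over a field and $M \neq (0)$ a finitely generated $R$-module. Then the following conditions are equivalent. 1. $M$ is a sequentially Cohen-Macaulay $R$-module. 2. $M_P$ is a sequentially Cohen-Macaulay $R_P$-module for every $P \in \mathrm{Supp}_R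 M$. -/

import Mathlib

namespace SeqCM

/-- The depth of a module `M` over a local ring `R`: the supremum of the lengths of the
`M`-regular sequences consisting of elements of the maximal ideal of `R`. -/
noncomputable def depth (R : Type*) [CommRing R] [IsLocalRing R]
    (M : Type*) [AddCommGroup M] [Module R M] : ℕ∞ :=
  ⨆ rs ∈ {rs : List R | (∀ r ∈ rs, r ∈ IsLocalRing.maximalIdeal R) ∧
    RingTheory.Sequence.IsRegular M rs}, (rs.length : ℕ∞)

/-- A (finitely generated) module `M` over a (Noetherian) ring `R` is Cohen-Macaulay if
`depth M_P = dim M_P` over the local ring `R_P` for every maximal ideal `P` in the support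
of `M`. The dimension is the Krull dimension of the support. -/
def IsCohenMacaulay (R : Type*) [CommRing R] (M : Type*) [AddCommGroup M] [Module R M] : Prop :=
  ∀ P : PrimeSpectrum R, P.asIdeal.IsMaximal → P ∈ Module.support R M →
    (depth (Localization.AtPrime P.asIdeal) (LocalizedModule P.asIdeal.primeCompl M) :
        WithBot ℕ∞) =
      Module.supportDim (Localization.AtPrime P.asIdeal)
        (LocalizedModule P.asIdeal.primeCompl M)

/-- The set `𝓢(M)` of the dimensions of the nonzero submodules of `M`. -/
def dimSet (R : Type*) [CommRing R] (M : Type*) [AddCommGroup M] [Module R M] :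
    Set (WithBot ℕ∞) :=
  {e | ∃ N : Submodule R M, N ≠ ⊥ ∧ Module.supportDim R N = e}

/-- `D 0, …, D ℓ` is the dimension filtration of `M`: writing `𝓢(M) = {d₁ < ⋯ < d_ℓ}`,
one has `D 0 = 0` and `D i` is the largest submodule of `M` of dimension at most `dᵢ` for
`1 ≤ i ≤ ℓ` (here `dᵢ` is `d (i - 1)`, as `Fin ℓ` starts at zero). -/
def IsDimensionFiltration (R : Type*) [CommRing R] (M : Type*) [AddCommGroup M] [Module R M]
    (ℓ : ℕ) (D : Fin (ℓ + 1) → Submodule R M) : Prop :=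
  D 0 = ⊥ ∧ ∃ d : Fin ℓ → WithBot ℕ∞, StrictMono d ∧ Set.range d = dimSet R M ∧
    ∀ i : Fin ℓ, IsGreatest {N : Submodule R M | Module.supportDim R N ≤ d i} (D i.succ)

/-- `M` is sequentially Cohen-Macaulay if the successive quotients `D i / D (i - 1)`,
`1 ≤ i ≤ ℓ`, of its dimension filtration are Cohen-Macaulay. The dimension filtration is unique
and it exists when `M` is finitely generated over a Noetherian ring. -/
def IsSequentiallyCohenMacaulay (R : Type*) [CommRing R]
    (M : Type*) [AddCommGroup M] [Module R M] : Prop :=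
  ∃ (ℓ : ℕ) (D : Fin (ℓ + 1) → Submodule R M), IsDimensionFiltration R M ℓ D ∧
    ∀ i : Fin ℓ, IsCohenMacaulay R (D i.succ ⧸ (D i.castSucc).submoduleOf (D i.succ))

end SeqCM

/-! The dimension filtration is indexed by the dimensions that occur in `M`, and this set changes
under localization. Index instead by all naturals: `dimLT R M n` is the largest submodule of
dimension less than `n`. It jumps from `n` to `n + 1` only when `n` occurs as a dimension, and zero
modules are Cohen-Macaulay, so `M` is sequentially Cohen-Macaulay iff every `dimLT (n + 1) / dimLT
n` is Cohen-Macaulay (`SeqCM.isSequentiallyCohenMacaulay_iff_dimLT`).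

For `R` of finite type over a field and primes `p ≤ P`, one has `dim R/p = dim R_P/pR_P + dim R/P`
(`PrimeSpectrum.coheight_comap_eq_add`). Hence localizing at `P` only shifts the index by `t = dim
R/P`: `dimLT (n + t)` of `M` becomes `dimLT n` of `M_P` (`localized'_dimLT`), and the quotients
localize accordingly.

One direction is then the stability of Cohen-Macaulayness under localization
(`IsCMOfDim.localization`), which rests on the freedom to cut by any regular element
(`IsCMOfDim.quotSMulTop`). The other uses maximal `P` only, where `t = 0` and the localized
condition is the definition. -/

/-! ### Heights and dimension in affine domains. -/

open Ideal Polynomial in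
theorem MvPolynomial.height_eq_of_isMaximal {k : Type*} [Field k] (n : ℕ)
    (m : Ideal (MvPolynomial (Fin n) k)) [m.IsMaximal] : m.height = n := by
  induction n with
  | zero =>
    have e : MvPolynomial (Fin 0) k ≃+* k := (MvPolynomial.isEmptyAlgEquiv k (Fin 0)).toRingEquiv
    have hf : IsField (MvPolynomial (Fin 0) k) := MulEquiv.isField (Field.toIsField k) e.toMulEquiv
    let := hf.toField
    rw [(Ideal.eq_bot_or_top m).resolve_right (Ideal.IsMaximal.ne_top ‹_›)]
    simp
  | succ n ih =>
    let e := (MvPolynomial.finSuccEquiv k n).toRingEquiv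
    have hm : (m.map e).IsMaximal := Ideal.map_isMaximal_of_equiv e
    -- Polynomial rings over a field are Jacobson, so the contraction stays maximal and the
    -- induction applies to it.
    have hc : ((m.map e).comap Polynomial.C).IsMaximal :=
      isMaximal_comap_C_of_isJacobsonRing _
    have : (m.map e).LiesOver ((m.map e).comap Polynomial.C) := ⟨rfl⟩
    have h1 := Polynomial.height_eq_height_add_one ((m.map e).comap Polynomial.C) (m.map e)
    rw [RingEquiv.height_map, ih] at h1
    rw [h1]; simp

theorem PrimeSpectrum.strictMono_comap_of_isIntegral {R S : Type*} [CommRing R] [CommRing S]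
    [Algebra R S] [Algebra.IsIntegral R S] :
    StrictMono (PrimeSpectrum.comap (algebraMap R S)) := by
  intro p q h
  obtain ⟨hle, x, hx, hx'⟩ := SetLike.lt_iff_le_and_exists.mp
    (show p.asIdeal < q.asIdeal from h)
  exact Ideal.comap_lt_comap_of_integral_mem_sdiff hle ⟨hx, hx'⟩ (Algebra.IsIntegral.isIntegral x)

/-- Going down gives `≤`; incomparability, which keeps chains strict under contraction, gives `≥`.
-/
theorem Ideal.height_under_of_isIntegral {R S : Type*} [CommRing R] [CommRing S] [Algebra R S]
    [IsNoetherianRing R] [IsNoetherianRing S] [Algebra.IsIntegral R S] [Algebra.HasGoingDown R S] (P : Ideal S)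
    [P.IsPrime] : (P.under R).height = P.height := by
  refine le_antisymm ?_ ?_
  · rw [Ideal.height_eq_height_add_of_liesOver_of_hasGoingDown (P.under R) P]
    exact le_self_add
  · have := Order.height_le_height_apply_of_strictMono _
      (PrimeSpectrum.strictMono_comap_of_isIntegral (R := R) (S := S)) ⟨P, inferInstance⟩
    rw [← PrimeSpectrum.height_eq_orderHeight, ← PrimeSpectrum.height_eq_orderHeight] at this
    exact this

section Affine

variable (k : Type*) [Field k] (A : Type*) [CommRing A] [IsDomain A] [Algebra k A]
  [Algebra.FiniteType k A]

-- Noether normalization: maximal ideals contract to maximal ideals of a polynomial ring, and going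
-- down over this normal domain preserves their height.
include k in
theorem exists_height_eq_of_isMaximal_of_finiteType :
    ∃ n : ℕ, ringKrullDim A = n ∧ ∀ m : Ideal A, m.IsMaximal → m.height = n := by
  obtain ⟨s, g, hg, hi⟩ := exists_integral_inj_algHom_of_fg k A
  have : IsNoetherianRing A := Algebra.FiniteType.isNoetherianRing k A
  let := g.toRingHom.toAlgebra
  have : Algebra.IsIntegral (MvPolynomial (Fin s) k) A := ⟨hi⟩
  have : FaithfulSMul (MvPolynomial (Fin s) k) A :=
    (faithfulSMul_iff_algebraMap_injective _ _).mpr hg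
  have key : ∀ m : Ideal A, m.IsMaximal → m.height = s := by
    intro m hm
    have : (m.under (MvPolynomial (Fin s) k)).IsMaximal :=
      Ideal.isMaximal_comap_of_isIntegral_of_isMaximal m
    rw [← Ideal.height_under_of_isIntegral (R := MvPolynomial (Fin s) k) m]
    exact MvPolynomial.height_eq_of_isMaximal s _
  refine ⟨s, ?_, key⟩
  rw [← Ideal.sup_isMaximal_height_eq_ringKrullDim]
  obtain ⟨m, hm⟩ := Ideal.exists_maximal A
  have : (⨆ (I : Ideal A) (_ : I.IsMaximal), I.height) = s :=
    le_antisymm (iSup₂_le fun m hm => (key m hm).le) ((key m hm).ge.trans (le_iSup₂_of_le m hm le_rfl))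
  rw [this]; rfl

/-- A maximal ideal containing `P` and no other minimal prime of `I`. -/
theorem Ideal.exists_isMaximal_le_forall_minimalPrimes {A : Type*} [CommRing A] [IsNoetherianRing A]
    [IsJacobsonRing A] {I P : Ideal A} (hP : P ∈ I.minimalPrimes) :
    ∃ m : Ideal A, m.IsMaximal ∧ P ≤ m ∧ ∀ q ∈ I.minimalPrimes, q ≤ m → q = P := by
  have hPp : P.IsPrime := hP.isPrime
  have hfin : (I.minimalPrimes \ {P}).Finite :=
    (Ideal.finite_minimalPrimes_of_isNoetherianRing A I).sdiff
  have hnot : ¬ (sInf (I.minimalPrimes \ {P}) ≤ P) := by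
    intro h
    have h' : hfin.toFinset.inf id ≤ P := by
      rwa [Finset.inf_id_eq_sInf, Set.Finite.coe_toFinset]
    obtain ⟨q, hq, hqP⟩ := (Ideal.IsPrime.inf_le' hPp).mp h'
    rw [Set.Finite.mem_toFinset] at hq
    exact hq.2 (le_antisymm hqP (hP.2 hq.1.1 hqP))
  obtain ⟨s, hs, hsP⟩ := SetLike.not_le_iff_exists.mp hnot
  -- `P` is an intersection of maximal ideals, so one of them above `P` misses `s`, which lies in
  -- every other minimal prime.
  have hj := (isJacobsonRing_iff_prime_eq.mp ‹_›) P hPp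
  rw [← hj, Ideal.jacobson, Submodule.mem_sInf] at hsP
  push Not at hsP
  obtain ⟨m, ⟨hPm, hm⟩, hsm⟩ := hsP
  refine ⟨m, hm, hPm, fun q hq hqm => ?_⟩
  by_contra hne
  exact hsm (hqm ((Submodule.mem_sInf.mp hs) q ⟨hq, hne⟩))

/-- Near `m` the locus of `I` has the single component `P`, so every prime of `A ⧸ I` below `m` lies
above `P`. -/
theorem Ideal.height_map_quotient_le {A : Type*} [CommRing A] {I P m : Ideal A} [P.IsPrime]
    [m.IsPrime] (hI : I ≤ m)
    (h : ∀ q ∈ I.minimalPrimes, q ≤ m → q = P) :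
    ((m.map (Ideal.Quotient.mk I)).height : WithBot ℕ∞) ≤ Order.coheight (⟨P, ‹_›⟩ : PrimeSpectrum A) := by
  have hm' : (m.map (Ideal.Quotient.mk I)).IsPrime := Ideal.isPrime_map_quotientMk_of_isPrime hI
  have := (PrimeSpectrum.height_eq_orderHeight ⟨m.map (Ideal.Quotient.mk I), hm'⟩)
  simp only at this
  rw [this, Order.height_eq_krullDim_Iic, Order.coheight_eq_krullDim_Ici]
  have hs : StrictMono (PrimeSpectrum.comap (Ideal.Quotient.mk I)) :=
    RingHom.strictMono_comap_of_surjective Ideal.Quotient.mk_surjective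
  have key : ∀ y : Set.Iic (⟨m.map (Ideal.Quotient.mk I), hm'⟩ : PrimeSpectrum (A ⧸ I)),
      PrimeSpectrum.comap (Ideal.Quotient.mk I) y.1 ∈ Set.Ici (⟨P, ‹_›⟩ : PrimeSpectrum A) := by
    rintro ⟨y, hy⟩
    have hIy : I ≤ y.asIdeal.comap (Ideal.Quotient.mk I) := by
      intro x hx
      rw [Ideal.mem_comap, Ideal.Quotient.eq_zero_iff_mem.mpr hx]; exact zero_mem _
    obtain ⟨q, hq, hqy⟩ := Ideal.exists_minimalPrimes_le hIy
    have hym : y.asIdeal.comap (Ideal.Quotient.mk I) ≤ m := by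
      refine (Ideal.comap_mono (f := Ideal.Quotient.mk I) (show y.asIdeal ≤ _ from hy)).trans ?_
      rw [Ideal.comap_map_of_surjective _ Ideal.Quotient.mk_surjective]
      simp [← RingHom.ker_eq_comap_bot, hI]
    have := h q hq (hqy.trans hym)
    subst this
    exact hqy
  exact Order.krullDim_le_of_strictMono (fun y => ⟨_, key y⟩) (fun a b hab => hs hab)

-- `P` is minimal over an ideal `I` generated by `height P` elements. For a maximal `m` containing
-- `P` and no other minimal prime of `I`, `dim A = height m ≤ height P + height (m/I)`, and the last
-- term is at most the coheight of `P`.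
include k in
theorem ringKrullDim_le_height_add_coheight (P : PrimeSpectrum A) :
    ringKrullDim A ≤ Order.height P + Order.coheight P := by
  have : IsNoetherianRing A := Algebra.FiniteType.isNoetherianRing k A
  have : IsJacobsonRing A := isJacobsonRing_of_finiteType (A := k)
  obtain ⟨n, hn, hm⟩ := exists_height_eq_of_isMaximal_of_finiteType k A
  obtain ⟨s, hs, hcard⟩ := P.asIdeal.exists_finset_card_eq_height_of_isNoetherianRing
  obtain ⟨m, hmax, hPm, huniq⟩ := Ideal.exists_isMaximal_le_forall_minimalPrimes hs
  have hIm : Ideal.span (s : Set A) ≤ m := hs.1.2.trans hPm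
  have h1 := Ideal.height_le_height_add_spanFinrank_of_le hIm
  have h2 := Ideal.height_map_quotient_le hIm huniq
  have h3 : ((Ideal.span (s : Set A)).spanFinrank : ℕ∞) ≤ s.card := by
    have := Submodule.spanFinrank_span_le_ncard_of_finite (R := A) (s := (s : Set A)) s.finite_toSet
    rw [Set.ncard_coe_finset] at this
    exact_mod_cast this
  rw [hm m hmax] at h1
  rw [hn, ← PrimeSpectrum.height_eq_orderHeight, ← hcard]
  have h4 : (n : ℕ∞) ≤ s.card + Order.coheight P := by
    refine h1.trans ?_
    rw [add_comm]
    exact add_le_add h3 (WithBot.coe_le_coe.mp h2)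
  exact_mod_cast WithBot.coe_le_coe.mpr h4

end Affine

/-! ### Chains through an intermediate prime and the dimension formula. -/

section Order

variable {α : Type*} [PartialOrder α]

theorem Order.height_Ici_eq_coheight_Iic {x y : α} (h : x ≤ y) :
    Order.height (⟨y, h⟩ : Set.Ici x) = Order.coheight (⟨x, h⟩ : Set.Iic y) := by
  rw [← WithBot.coe_inj, Order.height_eq_krullDim_Iic, Order.coheight_eq_krullDim_Ici]
  exact Order.krullDim_eq_of_orderIso
    { toFun := fun z => ⟨⟨z.1.1, z.2⟩, z.1.2⟩
      invFun := fun z => ⟨⟨z.1.1, z.2⟩, z.1.2⟩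
      left_inv := fun _ => rfl
      right_inv := fun _ => rfl
      map_rel_iff' := Iff.rfl }

theorem Order.coheight_Ici {x y : α} (h : x ≤ y) :
    Order.coheight (⟨y, h⟩ : Set.Ici x) = Order.coheight y := by
  rw [← WithBot.coe_inj, Order.coheight_eq_krullDim_Ici, Order.coheight_eq_krullDim_Ici]
  exact Order.krullDim_eq_of_orderIso
    { toFun := fun z => ⟨z.1.1, z.2⟩
      invFun := fun z => ⟨⟨z.1, h.trans z.2⟩, z.2⟩
      left_inv := fun _ => rfl
      right_inv := fun _ => rfl
      map_rel_iff' := Iff.rfl }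

end Order

namespace PrimeSpectrum

/-- The spectrum of `R ⧸ p` is the set of primes above `p`. -/
noncomputable def quotientOrderIsoIci {R : Type*} [CommRing R] (p : PrimeSpectrum R) :
    PrimeSpectrum (R ⧸ p.asIdeal) ≃o Set.Ici p :=
  p.asIdeal.primeSpectrumQuotientOrderIsoZeroLocus.trans
    (OrderIso.setCongr _ _ (by ext; rfl))

theorem ringKrullDim_quotient_eq_coheight {R : Type*} [CommRing R] (p : PrimeSpectrum R) :
    ringKrullDim (R ⧸ p.asIdeal) = Order.coheight p := by
  rw [Order.coheight_eq_krullDim_Ici]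
  exact Order.krullDim_eq_of_orderIso p.quotientOrderIsoIci

variable (k : Type*) [Field k] {R : Type*} [CommRing R] [Algebra k R] [Algebra.FiniteType k R]

include k in
theorem coheight_lt_top_of_finiteType (p : PrimeSpectrum R) : Order.coheight p < ⊤ := by
  obtain ⟨n, hn, -⟩ := exists_height_eq_of_isMaximal_of_finiteType k (R ⧸ p.asIdeal)
  rw [ringKrullDim_quotient_eq_coheight] at hn
  have : Order.coheight p = n := by exact_mod_cast hn
  rw [this]; exact ENat.natCast_lt_top n

include k in
/-- The dimension formula for algebras of finite type over a field. -/
theorem coheight_comap_eq_add (P : PrimeSpectrum R)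
    (q : PrimeSpectrum (Localization.AtPrime P.asIdeal)) :
    Order.coheight (comap (algebraMap R (Localization.AtPrime P.asIdeal)) q) =
      Order.coheight q + Order.coheight P := by
  let e := IsLocalization.AtPrime.primeSpectrumOrderIso (Localization.AtPrime P.asIdeal) P.asIdeal
  set p := comap (algebraMap R (Localization.AtPrime P.asIdeal)) q with hp
  have hpP : p ≤ P := (e q).2
  have h1 : Order.coheight q = Order.height (⟨P, hpP⟩ : Set.Ici p) := by
    rw [Order.height_Ici_eq_coheight_Iic hpP, ← Order.coheight_orderIso e q]
    rfl
  have h2 : Order.coheight P = Order.coheight (⟨P, hpP⟩ : Set.Ici p) :=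
    (Order.coheight_Ici hpP).symm
  have h3 : (Order.coheight p : WithBot ℕ∞) = Order.krullDim (Set.Ici p) :=
    Order.coheight_eq_krullDim_Ici p
  rw [h1, h2]
  -- The first inequality needs the affine domain `R ⧸ p`; the second is concatenation of chains.
  apply le_antisymm
  · have := ringKrullDim_le_height_add_coheight k (R ⧸ p.asIdeal)
      (p.quotientOrderIsoIci.symm ⟨P, hpP⟩)
    rw [ringKrullDim_quotient_eq_coheight, Order.height_orderIso, Order.coheight_orderIso] at this
    exact_mod_cast this
  · have hne : Nonempty (Set.Ici p) := ⟨⟨p, le_refl p⟩⟩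
    have := Order.krullDim_eq_iSup_height_add_coheight_of_nonempty (α := Set.Ici p)
    rw [← h3] at this
    rw [WithBot.coe_inj.mp this]
    exact le_iSup (fun a : Set.Ici p => Order.height a + Order.coheight a) ⟨P, hpP⟩

end PrimeSpectrum

/-! ### The filtration by dimension, indexed by the naturals. -/

section DimLT

variable (R : Type*) [CommRing R] (M : Type*) [AddCommGroup M] [Module R M]

/-- The submodule of the elements whose support has dimension less than `n`. -/
def dimLT (n : ℕ) : Submodule R M where
  carrier := {x | ∀ p : PrimeSpectrum R, Submodule.annihilator (R ∙ x) ≤ p.asIdeal →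
    Order.coheight p < n}
  add_mem' := by
    intro x y hx hy p hp
    have : (R ∙ x).annihilator ⊓ (R ∙ y).annihilator ≤ p.asIdeal := by
      refine le_trans (fun r hr => ?_) hp
      obtain ⟨h1, h2⟩ := hr
      rw [SetLike.mem_coe, Submodule.mem_annihilator_span_singleton] at *
      rw [smul_add, h1, h2, add_zero]
    rcases (Ideal.IsPrime.inf_le p.2).mp this with h | h
    · exact hx p h
    · exact hy p h
  zero_mem' := by
    intro p hp
    refine absurd ((Ideal.eq_top_iff_one _).mpr (hp ?_)) p.2.ne_top
    rw [Submodule.mem_annihilator_span_singleton, smul_zero]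
  smul_mem' := by
    intro r x hx p hp
    refine hx p (le_trans (fun s hs => ?_) hp)
    rw [Submodule.mem_annihilator_span_singleton] at *
    rw [smul_comm, hs, smul_zero]

variable {R M}

theorem mem_dimLT {n : ℕ} {x : M} : x ∈ dimLT R M n ↔ ∀ p : PrimeSpectrum R,
    (∀ r : R, r • x = 0 → r ∈ p.asIdeal) → Order.coheight p < n := by
  have : ∀ p : PrimeSpectrum R, Submodule.annihilator (R ∙ x) ≤ p.asIdeal ↔
      ∀ r : R, r • x = 0 → r ∈ p.asIdeal := fun p => by
    simp only [SetLike.le_def, Submodule.mem_annihilator_span_singleton]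
  exact forall_congr' fun p => imp_congr (this p) Iff.rfl

theorem mem_support_submodule_iff {N : Submodule R M} {p : PrimeSpectrum R} :
    p ∈ Module.support R N ↔ ∃ x ∈ N, ∀ r : R, r • x = 0 → r ∈ p.asIdeal := by
  rw [Module.mem_support_iff_exists_annihilator]
  simp only [SetLike.le_def, Submodule.mem_annihilator_span_singleton, Subtype.exists,
    SetLike.mk_smul_mk, Submodule.mk_eq_zero, exists_prop]

variable (R M) in
theorem Module.supportDim_eq_iSup_coheight :
    Module.supportDim R M = ⨆ p ∈ Module.support R M, (Order.coheight p : WithBot ℕ∞) := by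
  rw [Module.supportDim, Order.krullDim_eq_iSup_coheight, iSup_subtype]
  refine iSup_congr fun p => iSup_congr fun hp => ?_
  rw [Order.coheight_eq_krullDim_Ici, Order.coheight_eq_krullDim_Ici]
  exact Order.krullDim_eq_of_orderIso
    { toFun := fun z => ⟨z.1.1, z.2⟩
      invFun := fun z => ⟨⟨z.1, Module.mem_support_mono z.2 hp⟩, z.2⟩
      left_inv := fun _ => rfl
      right_inv := fun _ => rfl
      map_rel_iff' := Iff.rfl }

theorem Module.supportDim_lt_iff {n : ℕ} :
    Module.supportDim R M < n ↔ ∀ p ∈ Module.support R M, Order.coheight p < n := by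
  rw [Module.supportDim_eq_iSup_coheight]
  constructor
  · intro h p hp
    have := (le_iSup₂ (f := fun p (_ : p ∈ Module.support R M) =>
      (Order.coheight p : WithBot ℕ∞)) p hp).trans_lt h
    exact_mod_cast this
  · intro h
    -- A supremum of terms below `n` is bounded through `n - 1`; for `n = 0` the support is empty
    -- and the supremum is `⊥`.
    cases n with
    | zero =>
      have : ∀ p, p ∉ Module.support R M := fun p hp => by simpa using h p hp
      simp [this]
    | succ n =>
      refine lt_of_le_of_lt (b := ((n : ℕ∞) : WithBot ℕ∞)) (iSup₂_le fun p hp => ?_) ?_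
      · exact WithBot.coe_le_coe.mpr (Order.le_of_lt_add_one (by exact_mod_cast h p hp))
      · exact_mod_cast Nat.lt_succ_self n

/-- The support of `N` is the union of the supports of its cyclic submodules. This makes `dimLT R M
n` the largest submodule of dimension less than `n`, with no finiteness assumption. -/
theorem le_dimLT_iff {N : Submodule R M} {n : ℕ} :
    N ≤ dimLT R M n ↔ Module.supportDim R N < n := by
  rw [Module.supportDim_lt_iff]
  constructor
  · intro h p hp
    obtain ⟨x, hx, hxp⟩ := mem_support_submodule_iff.mp hp
    exact mem_dimLT.mp (h hx) p hxp
  · intro h x hx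
    exact mem_dimLT.mpr fun p hp => h p (mem_support_submodule_iff.mpr ⟨x, hx, hp⟩)

theorem supportDim_dimLT_lt (n : ℕ) : Module.supportDim R (dimLT R M n) < n :=
  le_dimLT_iff.mp le_rfl

theorem dimLT_zero : dimLT R M 0 = ⊥ := by
  rw [← Submodule.subsingleton_iff_eq_bot, ← Module.supportDim_eq_bot_iff_subsingleton R]
  have h := supportDim_dimLT_lt (R := R) (M := M) 0
  by_contra hne
  obtain ⟨d, hd⟩ := WithBot.ne_bot_iff_exists.mp hne
  rw [← hd] at h
  exact not_lt_zero (WithBot.coe_lt_coe.mp h)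

theorem dimLT_mono {m n : ℕ} (h : m ≤ n) : dimLT R M m ≤ dimLT R M n :=
  le_dimLT_iff.mpr ((supportDim_dimLT_lt m).trans_le (by exact_mod_cast h))

end DimLT

/-! ### The filtration under localization. -/

section Localization

variable {R : Type*} [CommRing R] {M : Type*} [AddCommGroup M] [Module R M]

/-- The kernel of `R → S⁻¹M`, `r ↦ r • m / 1`, is killed by a single element of `S` modulo the
annihilator of `m`. -/
theorem IsLocalizedModule.exists_forall_smul_eq_zero [IsNoetherianRing R] (S : Submonoid R)
    {N : Type*} [AddCommGroup N] [Module R N] (f : M →ₗ[R] N) [IsLocalizedModule S f] (m : M) :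
    ∃ u : S, ∀ r : R, f (r • m) = 0 → r • u • m = 0 := by
  classical
  obtain ⟨T, hT⟩ := IsNoetherian.noetherian (LinearMap.ker (f ∘ₗ LinearMap.toSpanSingleton R M m))
  -- Stated for all `a`, with the value `1` outside `T`, so that `choose` yields a total function to
  -- multiply over `T`.
  have h : ∀ a : R, ∃ v : S, a ∈ T → v • a • m = 0 := by
    intro a
    by_cases ha : a ∈ T
    · have h0 : a ∈ LinearMap.ker (f ∘ₗ LinearMap.toSpanSingleton R M m) :=
        hT ▸ Submodule.subset_span ha
      rw [LinearMap.mem_ker, LinearMap.comp_apply, LinearMap.toSpanSingleton_apply,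
        ← map_zero f] at h0
      obtain ⟨v, hv⟩ := IsLocalizedModule.exists_of_eq (S := S) h0
      exact ⟨v, fun _ => by rw [hv, smul_zero]⟩
    · exact ⟨1, fun h => absurd h ha⟩
  choose v hv using h
  refine ⟨∏ a ∈ T, v a, fun r hr => ?_⟩
  have hr' : r ∈ Submodule.span R (T : Set R) := by
    rw [hT]
    exact hr
  induction hr' using Submodule.span_induction with
  | mem a ha =>
    rw [Finset.prod_eq_prod_sdiff_singleton_mul (show a ∈ T from ha), mul_smul, smul_comm a,
      smul_comm a, hv a ha, smul_zero]
  | zero => rw [zero_smul]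
  | add a b ha hb iha ihb =>
    rw [add_smul, iha, ihb, add_zero]
    · have := hT ▸ hb
      exact this
    · have := hT ▸ ha
      exact this
  | smul a b hb ih =>
    rw [smul_assoc, ih, smul_zero]
    have := hT ▸ hb
    exact this

theorem mem_of_mk'_mem {S : Type*} [CommRing S] [Algebra R S] (p : Submonoid R)
    [IsLocalization p S] {q : Ideal S} {r : R} {s : p} (h : algebraMap R S r ∈ q) :
    IsLocalization.mk' S r s ∈ q := by
  rw [IsLocalization.mk'_eq_mul_mk'_one]
  exact Ideal.mul_mem_right _ _ h

variable (k : Type*) [Field k] [Algebra k R] [Algebra.FiniteType k R]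

include k in
theorem localized'_dimLT (P : PrimeSpectrum R) {t : ℕ} (ht : Order.coheight P = t) (n : ℕ) :
    (dimLT R M (n + t)).localized' (Localization.AtPrime P.asIdeal) P.asIdeal.primeCompl
      (LocalizedModule.mkLinearMap P.asIdeal.primeCompl M) =
    dimLT (Localization.AtPrime P.asIdeal) (LocalizedModule P.asIdeal.primeCompl M) n := by
  have : IsNoetherianRing R := Algebra.FiniteType.isNoetherianRing k R
  set f := LocalizedModule.mkLinearMap P.asIdeal.primeCompl M with hf
  have hlt : ∀ q : PrimeSpectrum (Localization.AtPrime P.asIdeal),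
      Order.coheight q < n ↔ Order.coheight (PrimeSpectrum.comap (algebraMap R _) q) <
        ((n + t : ℕ) : ℕ∞) := by
    intro q
    rw [PrimeSpectrum.coheight_comap_eq_add k P q, ht, Nat.cast_add]
    exact (ENat.add_lt_add_iff_right (ENat.natCast_ne_top t)).symm
  have hz : ∀ (r : R) (m : M) (s : P.asIdeal.primeCompl),
      r • IsLocalizedModule.mk' f m s = 0 ↔ f (r • m) = 0 := by
    intro r m s
    rw [← IsLocalizedModule.mk'_smul, IsLocalizedModule.mk'_eq_zero]
  ext y
  rw [Submodule.mem_localized', mem_dimLT]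
  constructor
  · rintro ⟨m, hm, s, rfl⟩ q hq
    rw [hlt]
    refine mem_dimLT.mp hm _ fun r hr => ?_
    refine hq _ ?_
    rw [algebraMap_smul, hz, hr, map_zero]
  · intro h
    obtain ⟨⟨m, s⟩, rfl⟩ := IsLocalizedModule.mk'_surjective P.asIdeal.primeCompl f y
    obtain ⟨u, hu⟩ := IsLocalizedModule.exists_forall_smul_eq_zero P.asIdeal.primeCompl f m
    -- The support of `m` may have large components not passing through `P`. Multiplying by `u`
    -- removes them: `u • m` is killed by `J`, whose minimal primes all lie below `P`.
    refine ⟨u • m, mem_dimLT.mpr fun p hp => ?_, u * s, IsLocalizedModule.mk'_cancel_left _ _ _ _⟩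
    let J : Ideal R := LinearMap.ker (f ∘ₗ LinearMap.toSpanSingleton R M m)
    have hJ : ∀ r, r ∈ J ↔ f (r • m) = 0 := fun r => Iff.rfl
    have hJp : J ≤ p.asIdeal := fun r hr => hp r (hu r hr)
    obtain ⟨p₀, hp₀, hp₀p⟩ := Ideal.exists_minimalPrimes_le hJp
    have hprime : p₀.IsPrime := hp₀.isPrime
    -- An element of `p₀` is a zero divisor modulo `J`, while elements outside `P` act injectively
    -- on the localization.
    have hp₀P : p₀ ≤ P.asIdeal := by
      intro r hr
      by_contra hrP
      obtain ⟨z, hz1, hz2⟩ := Ideal.exists_mul_mem_of_mem_minimalPrimes hp₀ hr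
      refine hz1 ?_
      rw [hJ, mul_smul, map_smul] at hz2
      rw [hJ]
      have := IsLocalizedModule.smul_injective f (⟨r, hrP⟩ : P.asIdeal.primeCompl)
      refine this ?_
      simp only [smul_zero]
      exact hz2
    let e := IsLocalization.AtPrime.primeSpectrumOrderIso (Localization.AtPrime P.asIdeal) P.asIdeal
    set q := e.symm ⟨⟨p₀, hprime⟩, hp₀P⟩ with hq
    have hqc : PrimeSpectrum.comap (algebraMap R _) q = ⟨p₀, hprime⟩ :=
      congrArg Subtype.val (e.apply_symm_apply ⟨⟨p₀, hprime⟩, hp₀P⟩)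
    have := h q ?_
    · rw [hlt, hqc] at this
      exact (Order.coheight_anti (show (⟨p₀, hprime⟩ : PrimeSpectrum R) ≤ p from hp₀p)).trans_lt this
    · intro r hr
      obtain ⟨a, b, rfl⟩ := IsLocalization.exists_mk'_eq P.asIdeal.primeCompl r
      refine mem_of_mk'_mem P.asIdeal.primeCompl ?_
      have ha : a ∈ p₀ := hp₀.1.2 <| by
        rw [hJ, ← hz a m s, ← algebraMap_smul (Localization.AtPrime P.asIdeal),
          ← IsLocalization.mk'_spec' _ a b, mul_smul]
        exact (congrArg _ hr).trans (smul_zero _)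
      have : a ∈ (PrimeSpectrum.comap (algebraMap R _) q).asIdeal := by rwa [hqc]
      exact this

theorem exists_isLocalizedModule_quotient_submoduleOf (S : Type*) [CommRing S] [Algebra R S]
    (p : Submonoid R) [IsLocalization p S] {M' : Type*} [AddCommGroup M'] [Module R M']
    [Module S M'] [IsScalarTower R S M'] (f : M →ₗ[R] M') [IsLocalizedModule p f]
    (N' N : Submodule R M) :
    ∃ g : (N ⧸ N'.submoduleOf N) →ₗ[R]
      (N.localized' S p f ⧸ (N'.localized' S p f).submoduleOf (N.localized' S p f)),
      IsLocalizedModule p g := by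
  have : (N'.localized' S p f).submoduleOf (N.localized' S p f) =
      (N'.submoduleOf N).localized' S p (N.toLocalized' S p f) := by
    ext ⟨y, hy⟩
    obtain ⟨m, hm, s, rfl⟩ := hy
    rw [Submodule.mem_localized']
    constructor
    · rintro ⟨m', hm', s', h⟩
      obtain ⟨c, hc⟩ := (IsLocalizedModule.mk'_eq_mk'_iff f _ _ _ _).mp h
      -- Only after clearing denominators does the numerator `m` land in `N'`; `c` comes from the
      -- equality of fractions.
      refine ⟨⟨c • s' • m, N.smul_mem _ (N.smul_mem _ hm)⟩, ?_, c * s' * s, ?_⟩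
      · change c • s' • m ∈ N'
        rw [hc]
        exact N'.smul_mem _ (N'.smul_mem _ hm')
      · rw [IsLocalizedModule.mk'_eq_iff]
        refine Subtype.ext ?_
        change f (c • s' • m) = (c * s' * s) • IsLocalizedModule.mk' f m s
        rw [mul_smul, mul_smul, IsLocalizedModule.mk'_cancel', Submonoid.smul_def,
          Submonoid.smul_def, Submonoid.smul_def, Submonoid.smul_def, map_smul, map_smul]
    · rintro ⟨⟨m', hm'N⟩, hm', s', h⟩
      rw [IsLocalizedModule.mk'_eq_iff] at h
      refine ⟨m', hm', s', ?_⟩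
      rw [IsLocalizedModule.mk'_eq_iff]
      exact congrArg Subtype.val h
  rw [this]
  exact ⟨_, IsLocalizedModule.toLocalizedQuotient' S p (N.toLocalized' S p f) (N'.submoduleOf N)⟩

end Localization

/-! ### Comparison with the dimension filtration. -/

namespace SeqCM

section

variable {R : Type*} [CommRing R] {M : Type*} [AddCommGroup M] [Module R M]

theorem exists_natCast_eq_of_mem_dimSet {d : ℕ} (hd : ∀ p : PrimeSpectrum R, Order.coheight p < d)
    {e : WithBot ℕ∞} (he : e ∈ dimSet R M) : ∃ n < d, e = (n : ℕ) := by
  obtain ⟨N, hN, rfl⟩ := he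
  have h1 : Module.supportDim R N < d := Module.supportDim_lt_iff.mpr fun p _ => hd p
  have h2 : Module.supportDim R N ≠ ⊥ := by
    rwa [Ne, Module.supportDim_eq_bot_iff_subsingleton, Submodule.subsingleton_iff_eq_bot]
  obtain ⟨m, hm⟩ := WithBot.ne_bot_iff_exists.mp h2
  rw [← hm] at h1 ⊢
  have h3 : m < d := by exact_mod_cast h1
  obtain ⟨n, rfl⟩ := ENat.ne_top_iff_exists.mp h3.ne_top
  exact ⟨n, by exact_mod_cast h3, rfl⟩

/-- If the larger submodule were not contained in the smaller, its own dimension would be an element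
of `dimSet R M` in `[a, b)`. -/
theorem dimLT_eq_of_forall_notMem_dimSet {a b : ℕ} (hab : a ≤ b)
    (h : ∀ c : ℕ, a ≤ c → c < b → (c : WithBot ℕ∞) ∉ dimSet R M) : dimLT R M a = dimLT R M b := by
  refine le_antisymm (dimLT_mono hab) ?_
  by_cases hb : dimLT R M b = ⊥
  · rw [hb]; exact bot_le
  · rw [le_dimLT_iff]
    have h1 := supportDim_dimLT_lt (R := R) (M := M) b
    have h2 : Module.supportDim R (dimLT R M b) ≠ ⊥ := by
      rwa [Ne, Module.supportDim_eq_bot_iff_subsingleton, Submodule.subsingleton_iff_eq_bot]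
    obtain ⟨m, hm⟩ := WithBot.ne_bot_iff_exists.mp h2
    have h3 : m < b := by rw [← hm] at h1; exact_mod_cast h1
    obtain ⟨n, rfl⟩ := ENat.ne_top_iff_exists.mp h3.ne_top
    have h4 : n < b := by exact_mod_cast h3
    by_contra hlt
    rw [← hm] at hlt
    have h5 : a ≤ n := by
      by_contra hlt'
      exact hlt (by exact_mod_cast not_le.mp hlt')
    exact h n h5 h4 ⟨_, hb, hm.symm⟩

theorem supportDim_le_natCast_iff {N : Submodule R M} {n : ℕ} :
    Module.supportDim R N ≤ n ↔ N ≤ dimLT R M (n + 1) := by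
  rw [le_dimLT_iff]
  generalize Module.supportDim R N = e
  induction e with
  | bot =>
    simp only [bot_le, true_iff]
    exact WithBot.bot_lt_coe _
  | coe e =>
    have h1 : ((e : WithBot ℕ∞) ≤ (n : WithBot ℕ∞)) ↔ e ≤ n := by norm_cast
    have h2 : ((e : WithBot ℕ∞) < ((n + 1 : ℕ) : WithBot ℕ∞)) ↔ e < ((n + 1 : ℕ) : ℕ∞) := by
      exact WithBot.coe_lt_coe
    rw [h1, h2, Nat.cast_add, Nat.cast_one, ENat.lt_add_one_iff (ENat.natCast_ne_top n)]

theorem isGreatest_dimLT (n : ℕ) :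
    IsGreatest {N : Submodule R M | Module.supportDim R N ≤ n} (dimLT R M (n + 1)) :=
  ⟨supportDim_le_natCast_iff.mpr le_rfl, fun _ hN => supportDim_le_natCast_iff.mp hN⟩

/-- The terms of a dimension filtration in terms of `dimLT`. -/
theorem eq_dimLT_of_isGreatest {d : ℕ} (hd : ∀ p : PrimeSpectrum R, Order.coheight p < d)
    {ℓ : ℕ} {D : Fin (ℓ + 1) → Submodule R M} (h0 : D 0 = ⊥) {e : Fin ℓ → WithBot ℕ∞}
    (hmono : StrictMono e) (hrange : Set.range e = dimSet R M)
    (hD : ∀ i : Fin ℓ, IsGreatest {N : Submodule R M | Module.supportDim R N ≤ e i} (D i.succ))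
    (i : Fin ℓ) {n : ℕ} (hn : e i = n) :
    D i.succ = dimLT R M (n + 1) ∧ D i.castSucc = dimLT R M n := by
  have key : ∀ (j : Fin ℓ) (m : ℕ), e j = m → D j.succ = dimLT R M (m + 1) := by
    intro j m hm
    refine (hD j).unique ?_
    rw [hm]
    exact isGreatest_dimLT m
  refine ⟨key i n hn, ?_⟩
  -- `dimLT` is constant below the first dimension and strictly between consecutive ones, so the
  -- preceding term is `dimLT R M n` in both cases.
  rcases Nat.eq_zero_or_pos i.1 with h | h
  · have : i.castSucc = 0 := Fin.ext h
    rw [this, h0, ← dimLT_zero]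
    refine dimLT_eq_of_forall_notMem_dimSet (Nat.zero_le n) fun c _ hc hmem => ?_
    obtain ⟨j, hj⟩ := hrange ▸ hmem
    have hlt : e j < e i := by rw [hj, hn]; exact_mod_cast hc
    have := hmono.lt_iff_lt.mp hlt
    omega
  · let j : Fin ℓ := ⟨i.1 - 1, by omega⟩
    have hj : i.castSucc = j.succ := Fin.ext (by simp [j]; omega)
    obtain ⟨m, -, hm⟩ := exists_natCast_eq_of_mem_dimSet hd (hrange ▸ Set.mem_range_self j)
    rw [hj, key j m hm]
    have hmn : m < n := by
      have : e j < e i := hmono (Fin.lt_def.mpr (by simp [j]; omega))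
      rw [hm, hn] at this
      exact_mod_cast this
    refine dimLT_eq_of_forall_notMem_dimSet hmn fun c hc1 hc2 hmem => ?_
    obtain ⟨l, hl⟩ := hrange ▸ hmem
    have hlt : e l < e i := by rw [hl, hn]; exact_mod_cast hc2
    have hlt' : e j < e l := by rw [hl, hm]; exact_mod_cast hc1
    have h1 := Fin.lt_def.mp (hmono.lt_iff_lt.mp hlt)
    have h2 := Fin.lt_def.mp (hmono.lt_iff_lt.mp hlt')
    simp only [j] at h2
    omega

theorem isCohenMacaulay_of_subsingleton [Subsingleton M] : IsCohenMacaulay R M := by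
  intro P _ hP
  rw [Module.support_eq_empty] at hP
  exact absurd hP (Set.notMem_empty P)

theorem isSequentiallyCohenMacaulay_iff_dimLT {d : ℕ}
    (hd : ∀ p : PrimeSpectrum R, Order.coheight p < d) :
    IsSequentiallyCohenMacaulay R M ↔ ∀ n : ℕ, IsCohenMacaulay R
      (dimLT R M (n + 1) ⧸ (dimLT R M n).submoduleOf (dimLT R M (n + 1))) := by
  classical
  constructor
  · rintro ⟨ℓ, D, ⟨h0, e, hmono, hrange, hD⟩, hCM⟩ n
    by_cases hn : (n : WithBot ℕ∞) ∈ dimSet R M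
    · obtain ⟨i, hi⟩ := hrange ▸ hn
      obtain ⟨h1, h2⟩ := eq_dimLT_of_isGreatest hd h0 hmono hrange hD i hi
      have := hCM i
      rwa [h1, h2] at this
    · have : dimLT R M n = dimLT R M (n + 1) :=
        dimLT_eq_of_forall_notMem_dimSet (Nat.le_succ n) fun c h1 h2 hc =>
          hn (by rwa [show n = c by omega])
      rw [← this]
      have : Subsingleton (dimLT R M n ⧸ (dimLT R M n).submoduleOf (dimLT R M n)) := by
        rw [Submodule.Quotient.subsingleton_iff, Submodule.submoduleOf_self]
      exact isCohenMacaulay_of_subsingleton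
  · intro h
    let T : Finset ℕ := (Finset.range d).filter fun n => (n : WithBot ℕ∞) ∈ dimSet R M
    let e : Fin T.card → WithBot ℕ∞ := fun i => ((T.orderEmbOfFin rfl i : ℕ) : WithBot ℕ∞)
    have hmono : StrictMono e := fun i j hij => by
      have := (T.orderEmbOfFin rfl).strictMono hij
      simp only [e]
      exact_mod_cast this
    have hrange : Set.range e = dimSet R M := by
      ext x
      constructor
      · rintro ⟨i, rfl⟩
        exact (Finset.mem_filter.mp (T.orderEmbOfFin_mem rfl i)).2
      · intro hx
        obtain ⟨n, hn, rfl⟩ := exists_natCast_eq_of_mem_dimSet hd hx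
        have hnT : n ∈ T := Finset.mem_filter.mpr ⟨Finset.mem_range.mpr hn, hx⟩
        have : n ∈ Set.range (T.orderEmbOfFin rfl) := by rw [Finset.range_orderEmbOfFin]; exact hnT
        obtain ⟨i, hi⟩ := this
        exact ⟨i, by simp only [e, hi]⟩
    let D : Fin (T.card + 1) → Submodule R M :=
      Fin.cases ⊥ fun i => dimLT R M (T.orderEmbOfFin rfl i + 1)
    have h0 : D 0 = ⊥ := rfl
    have hD : ∀ i : Fin T.card, IsGreatest {N : Submodule R M | Module.supportDim R N ≤ e i}
        (D i.succ) := fun i => isGreatest_dimLT _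
    refine ⟨T.card, D, ⟨h0, e, hmono, hrange, hD⟩, fun i => ?_⟩
    obtain ⟨h1, h2⟩ := eq_dimLT_of_isGreatest hd h0 hmono hrange hD i rfl
    rw [h1, h2]
    exact h _

end

end SeqCM

/-! ### Cohen-Macaulay modules over a Noetherian local ring. -/

section

open IsLocalRing RingTheory.Sequence Pointwise

namespace QuotSMulTop

variable {R : Type*} [CommRing R] (M : Type*) [AddCommGroup M] [Module R M]

/-- `M / (y)M` as a quotient by the ideal generated by the one-element list. -/
def equivOfListSingleton (y : R) :
    (M ⧸ (Ideal.ofList [y] • ⊤ : Submodule R M)) ≃ₗ[R] QuotSMulTop y M :=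
  Submodule.quotEquivOfEq _ _ (by rw [Ideal.ofList_singleton, Submodule.ideal_span_singleton_smul])

/-- Reductions modulo two elements commute. -/
noncomputable def comm (x y : R) :
    QuotSMulTop y (QuotSMulTop x M) ≃ₗ[R] QuotSMulTop x (QuotSMulTop y M) :=
  (equivOfListSingleton (QuotSMulTop x M) y).symm ≪≫ₗ
    (Submodule.quotOfListConsSMulTopEquivQuotSMulTopInner M x [y]).symm ≪≫ₗ
    Submodule.quotOfListConsSMulTopEquivQuotSMulTopOuter M x [y] ≪≫ₗ
    QuotSMulTop.congr x (equivOfListSingleton M y)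

end QuotSMulTop

theorem Ideal.exists_mem_isSMulRegular {R : Type*} [CommRing R] [IsNoetherianRing R] {M : Type*}
    [AddCommGroup M] [Module R M] [Module.Finite R M] {I : Ideal R}
    (h : ∀ q ∈ associatedPrimes R M, ¬ I ≤ q) : ∃ x ∈ I, IsSMulRegular M x := by
  have hfin := associatedPrimes.finite R M
  by_contra hcon
  push Not at hcon
  have hsub : (I : Set R) ⊆ ⋃ q ∈ (↑hfin.toFinset : Set (Ideal R)), (q : Set R) := by
    rw [Set.Finite.coe_toFinset, biUnion_associatedPrimes_eq_compl_regular]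
    exact fun x hx => hcon x hx
  -- Prime avoidance permits two non-prime exceptions; none is needed, so `⊥` is a filler.
  obtain ⟨q, hq, hIq⟩ := (Ideal.subset_union_prime (f := id) ⊥ ⊥ (fun q hq _ _ =>
    ((Set.Finite.mem_toFinset hfin).mp hq).isPrime)).mp hsub
  exact h q ((Set.Finite.mem_toFinset hfin).mp hq) hIq

theorem IsSMulRegular.not_mem_of_mem_associatedPrimes {R : Type*} [CommRing R] [IsNoetherianRing R]
    {M : Type*} [AddCommGroup M] [Module R M] {x : R} (hx : IsSMulRegular M x) {q : Ideal R}
    (hq : q ∈ associatedPrimes R M) : x ∉ q := by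
  intro hxq
  have : x ∈ ⋃ p ∈ associatedPrimes R M, (p : Set R) := Set.mem_iUnion₂_of_mem hq hxq
  rw [biUnion_associatedPrimes_eq_compl_regular] at this
  exact this hx

section Local

variable {A : Type*} [CommRing A] [IsLocalRing A]

theorem IsLocalRing.isSMulRegular_quotSMulTop_comm [IsNoetherianRing A] {X : Type*} [AddCommGroup X]
    [Module A X] [Module.Finite A X] {x y : A} (hx : x ∈ maximalIdeal A) (hy : y ∈ maximalIdeal A)
    (h1 : IsSMulRegular X x) (h2 : IsSMulRegular (QuotSMulTop x X) y) :
    IsSMulRegular X y ∧ IsSMulRegular (QuotSMulTop y X) x := by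
  have h : IsWeaklyRegular X [x, y] := by
    rw [isWeaklyRegular_cons_iff, isWeaklyRegular_singleton_iff]
    exact ⟨h1, h2⟩
  have := IsLocalRing.isWeaklyRegular_of_perm_of_subset_maximalIdeal h (List.Perm.swap y x [])
    (by
      intro r hr
      rcases List.mem_pair.mp hr with rfl | rfl
      · exact hx
      · exact hy)
  rwa [isWeaklyRegular_cons_iff, isWeaklyRegular_singleton_iff] at this

/-- `X` is Cohen-Macaulay of dimension `n`: it has a regular sequence of length `n` in the maximal
ideal with zero-dimensional quotient. -/
def IsCMOfDim (A : Type*) [CommRing A] [IsLocalRing A] :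
    ℕ → ∀ (X : Type*) [AddCommGroup X] [Module A X], Prop
  | 0, X, _, _ => Module.supportDim A X = 0
  | n + 1, X, _, _ => ∃ x ∈ maximalIdeal A, IsSMulRegular X x ∧ IsCMOfDim A n (QuotSMulTop x X)

variable {X : Type*} [AddCommGroup X] [Module A X]

theorem IsCMOfDim.of_equiv {n : ℕ} {Y : Type*} [AddCommGroup Y] [Module A Y] (e : X ≃ₗ[A] Y)
    (h : IsCMOfDim A n X) : IsCMOfDim A n Y := by
  induction n generalizing X Y with
  | zero => exact (Module.supportDim_eq_of_equiv e).symm.trans h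
  | succ n ih =>
    obtain ⟨x, hx, hreg, h⟩ := h
    exact ⟨x, hx, (e.isSMulRegular_congr x).mp hreg, ih (QuotSMulTop.congr x e) h⟩

variable [IsNoetherianRing A] [Module.Finite A X]

theorem IsCMOfDim.supportDim_eq {n : ℕ} (h : IsCMOfDim A n X) : Module.supportDim A X = n := by
  induction n generalizing X with
  | zero => exact h
  | succ n ih =>
    obtain ⟨x, hx, hreg, h⟩ := h
    rw [← Module.supportDim_quotSMulTop_succ_eq_supportDim hreg hx, ih h]
    rfl

theorem IsCMOfDim.nontrivial {n : ℕ} (h : IsCMOfDim A n X) : Nontrivial X := by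
  rw [← Module.supportDim_ne_bot_iff_nontrivial A, h.supportDim_eq]
  exact WithBot.coe_ne_bot

/-- An associated prime of `X` is contained in one of `X / yX` which contains `y`. -/
theorem exists_mem_associatedPrimes_quotSMulTop {y : A} (hy : y ∈ maximalIdeal A)
    (hreg : IsSMulRegular X y) {q : Ideal A} (hq : q ∈ associatedPrimes A X) :
    ∃ q' ∈ associatedPrimes A (QuotSMulTop y X), q ≤ q' ∧ y ∈ q' := by
  obtain ⟨hprime, x, hx⟩ := (isAssociatedPrime_iff ..).mp hq
  let N : Submodule A X := Submodule.torsionBySet A X q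
  have hxN : x ∈ N := by
    rw [Submodule.mem_torsionBySet_iff]
    rintro ⟨a, ha⟩
    have ha' : a ∈ (⊥ : Submodule A X).colon {x} := hx ▸ ha
    rwa [Submodule.mem_colon_singleton] at ha'
  have hx0 : x ≠ 0 := by
    rintro rfl
    exact hprime.ne_top (by rw [hx]; simp)
  -- As `y` is regular, `N ≤ yX` would force `N ≤ yN`, hence `N = 0` by Nakayama. An element of `N`
  -- outside `yX` then has a nonzero class killed by both `q` and `y`.
  have hN : ¬ N ≤ y • (⊤ : Submodule A X) := by
    intro hle
    have hbot : N = ⊥ := by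
      refine Submodule.eq_bot_of_le_smul_of_le_jacobson_bot (Ideal.span {y}) N
        (IsNoetherian.noetherian N) ?_ ?_
      · intro u hu
        obtain ⟨v, -, rfl⟩ := (Submodule.mem_smul_pointwise_iff_exists _ _ _).mp (hle hu)
        rw [Submodule.ideal_span_singleton_smul]
        refine Submodule.smul_mem_pointwise_smul _ _ _ ?_
        rw [Submodule.mem_torsionBySet_iff] at hu ⊢
        intro a
        have := hu a
        refine hreg ?_
        simp only [smul_zero]
        rw [smul_comm]
        exact this
      · rw [IsLocalRing.jacobson_eq_maximalIdeal _ bot_ne_top]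
        exact (Ideal.span_singleton_le_iff_mem _).mpr hy
    rw [hbot] at hxN
    exact hx0 hxN
  obtain ⟨u, huN, hu⟩ := SetLike.not_le_iff_exists.mp hN
  have hu0 : (Submodule.Quotient.mk u : QuotSMulTop y X) ≠ 0 := by
    rwa [Ne, Submodule.Quotient.mk_eq_zero]
  obtain ⟨q', hq', hle⟩ := exists_le_isAssociatedPrime_of_isNoetherianRing A
    (Submodule.Quotient.mk u : QuotSMulTop y X) hu0
  refine ⟨q', hq', fun a ha => hle ?_, hle ?_⟩
  · rw [Submodule.mem_colon_singleton, ← Submodule.Quotient.mk_smul]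
    have : a • u = 0 := (Submodule.mem_torsionBySet_iff _ _).mp huN ⟨a, ha⟩
    rw [this]; exact zero_mem _
  · rw [Submodule.mem_colon_singleton, ← Submodule.Quotient.mk_smul, Submodule.mem_bot,
      Submodule.Quotient.mk_eq_zero]
    exact Submodule.smul_mem_pointwise_smul _ _ _ trivial

/-- Cohen-Macaulay modules are unmixed. -/
theorem IsCMOfDim.le_coheight {n : ℕ} (h : IsCMOfDim A n X) {q : PrimeSpectrum A}
    (hq : q.asIdeal ∈ associatedPrimes A X) : n ≤ Order.coheight q := by
  induction n generalizing X q with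
  | zero => simp
  | succ n ih =>
    obtain ⟨y, hy, hreg, h⟩ := h
    obtain ⟨q', hq', hle, hyq'⟩ := exists_mem_associatedPrimes_quotSMulTop hy hreg hq
    have hlt : q < ⟨q', hq'.isPrime⟩ := lt_of_le_of_ne hle fun heq =>
      hreg.not_mem_of_mem_associatedPrimes hq (heq ▸ hyq' : y ∈ q.asIdeal)
    have h1 := ih h (q := ⟨q', hq'.isPrime⟩) hq'
    have h2 := Order.coheight_add_one_le hlt
    rw [Nat.cast_add, Nat.cast_one]
    exact (add_le_add h1 le_rfl).trans h2

-- If the maximal ideal kills the class of `u`, then `y u = x v` and `z u = x w`. Cancelling `x`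
-- gives `z v = y w`, so `v ∈ yX` by regularity of `z`, and cancelling `y` gives `u ∈ xX`.
omit [Module.Finite A X] in
theorem maximalIdeal_notMem_associatedPrimes_quotSMulTop {x y z : A} (hx : IsSMulRegular X x)
    (hy : y ∈ maximalIdeal A)
    (hyreg : IsSMulRegular X y) (hz : z ∈ maximalIdeal A)
    (hzreg : IsSMulRegular (QuotSMulTop y X) z) :
    ∀ q ∈ associatedPrimes A (QuotSMulTop x X), ¬ maximalIdeal A ≤ q := by
  intro q hq hle
  obtain ⟨hprime, u, hu⟩ := (isAssociatedPrime_iff ..).mp hq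
  obtain ⟨u, rfl⟩ := Submodule.Quotient.mk_surjective _ u
  have hux : u ∉ x • (⊤ : Submodule A X) := by
    intro h
    have : (Submodule.Quotient.mk u : QuotSMulTop x X) = 0 := (Submodule.Quotient.mk_eq_zero _).mpr h
    exact hprime.ne_top (by rw [hu, this]; simp)
  have hmul : ∀ a ∈ maximalIdeal A, ∃ w : X, a • u = x • w := by
    intro a ha
    have := hu ▸ hle ha
    rw [Submodule.mem_colon_singleton, ← Submodule.Quotient.mk_smul, Submodule.mem_bot,
      Submodule.Quotient.mk_eq_zero] at this
    obtain ⟨w, -, hw⟩ := (Submodule.mem_smul_pointwise_iff_exists _ _ _).mp this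
    exact ⟨w, hw.symm⟩
  obtain ⟨v, hv⟩ := hmul y hy
  obtain ⟨w, hw⟩ := hmul z hz
  have hzv : z • v = y • w := hx <| by
    simp only
    rw [smul_comm x z, ← hv, smul_comm z y, hw, smul_comm y x]
  have hv0 : (Submodule.Quotient.mk v : QuotSMulTop y X) = 0 := by
    refine hzreg ?_
    simp only [smul_zero]
    rw [← Submodule.Quotient.mk_smul, hzv, Submodule.Quotient.mk_eq_zero]
    exact Submodule.smul_mem_pointwise_smul _ _ _ trivial
  rw [Submodule.Quotient.mk_eq_zero] at hv0
  obtain ⟨v', -, rfl⟩ := (Submodule.mem_smul_pointwise_iff_exists _ _ _).mp hv0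
  refine hux ?_
  have : u = x • v' := hyreg <| by
    simp only
    rw [hv, smul_comm]
  rw [this]
  exact Submodule.smul_mem_pointwise_smul _ _ _ trivial

/-- The definition provides one good regular element `y`; this allows any `x`. A `z` regular on both
`X/xX` and `X/yX` links them: by induction `X/(y,z)X`, then `X/zX`, then `X/(z,x)X` and finally
`X/xX` are Cohen-Macaulay. -/
theorem IsCMOfDim.quotSMulTop {n : ℕ} (h : IsCMOfDim A (n + 1) X) {x : A}
    (hx : x ∈ maximalIdeal A) (hreg : IsSMulRegular X x) : IsCMOfDim A n (QuotSMulTop x X) := by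
  induction n generalizing X x with
  | zero =>
    have h1 := Module.supportDim_quotSMulTop_succ_eq_supportDim hreg hx
    rw [h.supportDim_eq] at h1
    change Module.supportDim A (QuotSMulTop x X) = 0
    generalize Module.supportDim A (QuotSMulTop x X) = e at h1
    induction e with
    | bot => simp at h1
    | coe e =>
      have h2 : e + 1 = 1 := by exact_mod_cast h1
      have h3 : e = 0 := by
        have : e + 1 = 0 + 1 := by rw [h2, zero_add]
        exact WithTop.add_right_cancel ENat.one_ne_top this
      rw [h3]; rfl
  | succ n ih =>
    obtain ⟨y, hy, hyreg, h⟩ := h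
    have h' := h
    obtain ⟨w, hw, hwreg, -⟩ := h'
    obtain ⟨z, hz, hzreg⟩ : ∃ z ∈ maximalIdeal A,
        IsSMulRegular (QuotSMulTop x X × QuotSMulTop y X) z := by
      refine Ideal.exists_mem_isSMulRegular fun q hq => ?_
      rw [associatedPrimes.prod] at hq
      rcases hq with hq | hq
      · exact maximalIdeal_notMem_associatedPrimes_quotSMulTop hreg hy hyreg hw hwreg q hq
      · exact fun hle => hwreg.not_mem_of_mem_associatedPrimes hq (hle hw)
    have hzx : IsSMulRegular (QuotSMulTop x X) z :=
      hzreg.of_injective (LinearMap.inl A _ _) LinearMap.inl_injective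
    have hzy : IsSMulRegular (QuotSMulTop y X) z :=
      hzreg.of_injective (LinearMap.inr A _ _) LinearMap.inr_injective
    obtain ⟨-, hyz⟩ := isSMulRegular_quotSMulTop_comm hy hz hyreg hzy
    obtain ⟨-, hxz⟩ := isSMulRegular_quotSMulTop_comm hx hz hreg hzx
    have h1 : IsCMOfDim A (n + 1) (QuotSMulTop z X) :=
      ⟨y, hy, hyz, (ih h hz hzy).of_equiv (QuotSMulTop.comm X y z)⟩
    exact ⟨z, hz, hzx, (ih h1 hx hxz).of_equiv (QuotSMulTop.comm X z x)⟩

end Local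

section Local

variable {A : Type*} [CommRing A] [IsLocalRing A] [IsNoetherianRing A]
  {X : Type*} [AddCommGroup X] [Module A X] [Module.Finite A X]

theorem WithBot.eq_natCast_of_add_one_eq {e : WithBot ℕ∞} {n : ℕ} (h : e + 1 = (n + 1 : ℕ)) :
    e = n := by
  induction e with
  | bot => exact absurd h (by rw [WithBot.bot_add]; exact WithBot.bot_ne_coe)
  | coe e =>
    have h2 : e + 1 = (n : ℕ∞) + 1 := by exact_mod_cast h
    rw [WithTop.add_right_cancel ENat.one_ne_top h2]
    rfl

theorem RingTheory.Sequence.IsRegular.isCMOfDim {rs : List A} (h : IsRegular X rs)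
    (hrs : ∀ r ∈ rs, r ∈ maximalIdeal A) (hdim : Module.supportDim A X = rs.length) :
    IsCMOfDim A rs.length X := by
  induction rs generalizing X with
  | nil => exact hdim
  | cons r rs ih =>
    have hr := hrs r List.mem_cons_self
    obtain ⟨h1, h2⟩ := (isRegular_cons_iff _ _ _).mp h
    refine ⟨r, hr, h1, ih h2 (fun s hs => hrs s (List.mem_cons_of_mem _ hs)) ?_⟩
    refine WithBot.eq_natCast_of_add_one_eq ?_
    rw [Module.supportDim_quotSMulTop_succ_eq_supportDim h1 hr, hdim, List.length_cons]

theorem IsCMOfDim.exists_isRegular {n : ℕ} (h : IsCMOfDim A n X) :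
    ∃ rs : List A, (∀ r ∈ rs, r ∈ maximalIdeal A) ∧ IsRegular X rs ∧ rs.length = n := by
  induction n generalizing X with
  | zero =>
    have := h.nontrivial
    exact ⟨[], by simp, IsRegular.nil A X, rfl⟩
  | succ n ih =>
    obtain ⟨x, hx, hreg, h⟩ := h
    obtain ⟨rs, h1, h2, h3⟩ := ih h
    refine ⟨x :: rs, ?_, (isRegular_cons_iff _ _ _).mpr ⟨hreg, h2⟩, by rw [List.length_cons, h3]⟩
    intro r hr
    rcases List.mem_cons.mp hr with rfl | hr
    exacts [hx, h1 r hr]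

theorem SeqCM.depth_le_supportDim [Nontrivial X] :
    (SeqCM.depth A X : WithBot ℕ∞) ≤ Module.supportDim A X := by
  have hbot : Module.supportDim A X ≠ ⊥ := Module.supportDim_ne_bot_of_nontrivial A X
  obtain ⟨e, he⟩ := WithBot.ne_bot_iff_exists.mp hbot
  rw [← he, WithBot.coe_le_coe]
  refine iSup₂_le fun rs hrs => ?_
  have h := Module.supportDim_add_length_eq_supportDim_of_isRegular rs hrs.2
  have := hrs.2.quot_ofList_smul_nontrivial (⊤ : Submodule A X)
  obtain ⟨e', he'⟩ := WithBot.ne_bot_iff_exists.mp (Module.supportDim_ne_bot_of_nontrivial A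
    (X ⧸ Ideal.ofList rs • (⊤ : Submodule A X)))
  rw [← he, ← he'] at h
  have h' : e' + (rs.length : ℕ∞) = e := by exact_mod_cast h
  rw [← h']
  exact le_add_self

theorem SeqCM.depth_eq_supportDim_iff [Nontrivial X] :
    (SeqCM.depth A X : WithBot ℕ∞) = Module.supportDim A X ↔ ∃ n, IsCMOfDim A n X := by
  constructor
  · intro h
    have hfin : Module.supportDim A X ≠ ⊤ :=
      ne_top_of_le_ne_top (ringKrullDim_ne_top (R := A)) (Module.supportDim_le_ringKrullDim A X)
    rw [← h] at hfin
    obtain ⟨n, hn⟩ : ∃ n : ℕ, SeqCM.depth A X = n :=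
      ⟨_, (ENat.natCast_toNat fun h' => hfin (by rw [h']; rfl)).symm⟩
    -- A finite supremum in `ℕ∞` is attained; for the value `0` the empty sequence serves, as `X` is
    -- nontrivial.
    have : ∃ rs : List A, (∀ r ∈ rs, r ∈ maximalIdeal A) ∧ IsRegular X rs ∧ n ≤ rs.length := by
      by_contra! hcon
      cases n with
      | zero => simpa using hcon [] (by simp) (IsRegular.nil A X)
      | succ n =>
        have : SeqCM.depth A X ≤ (n : ℕ∞) := iSup₂_le fun rs hrs => by
          exact_mod_cast Nat.lt_succ_iff.mp (hcon rs hrs.1 hrs.2)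
        rw [hn] at this
        have : n + 1 ≤ n := by exact_mod_cast this
        omega
    obtain ⟨rs, h1, h2, h3⟩ := this
    have h4 : (rs.length : ℕ∞) ≤ SeqCM.depth A X :=
      le_iSup₂_of_le (f := fun (rs : List A) (_ : rs ∈ {rs : List A | (∀ r ∈ rs,
        r ∈ maximalIdeal A) ∧ IsRegular X rs}) => (rs.length : ℕ∞)) rs ⟨h1, h2⟩ le_rfl
    have h5 : rs.length = n := le_antisymm (by rw [hn] at h4; exact_mod_cast h4) h3
    refine ⟨_, h2.isCMOfDim h1 ?_⟩
    rw [← h, hn, h5]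
    rfl
  · rintro ⟨n, h⟩
    refine le_antisymm SeqCM.depth_le_supportDim ?_
    obtain ⟨rs, h1, h2, h3⟩ := h.exists_isRegular
    rw [h.supportDim_eq, ← h3]
    change (((rs.length : ℕ∞)) : WithBot ℕ∞) ≤ _
    rw [WithBot.coe_le_coe]
    exact le_iSup₂_of_le (f := fun (rs : List A) (_ : rs ∈ {rs : List A | (∀ r ∈ rs,
        r ∈ maximalIdeal A) ∧ IsRegular X rs}) => (rs.length : ℕ∞)) rs ⟨h1, h2⟩ le_rfl

end Local

/-! ### Localization of Cohen-Macaulay modules. -/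

section Localization

open PrimeSpectrum

variable {A : Type*} [CommRing A] [IsLocalRing A] [IsNoetherianRing A]
  {X : Type*} [AddCommGroup X] [Module A X] [Module.Finite A X]

/-- The associated primes of a Cohen-Macaulay module are minimal in its support. -/
theorem IsCMOfDim.eq_of_le_of_mem_associatedPrimes {n : ℕ} (h : IsCMOfDim A n X)
    {q p : PrimeSpectrum A} (hq : q.asIdeal ∈ associatedPrimes A X) (hp : p ∈ Module.support A X)
    (hle : p ≤ q) : p = q := by
  by_contra hne
  have hlt := lt_of_le_of_ne hle hne
  have h1 := h.le_coheight hq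
  have h2 := Order.coheight_add_one_le hlt
  have h3 : Order.coheight p < ((n + 1 : ℕ) : ℕ∞) := by
    refine Module.supportDim_lt_iff.mp ?_ p hp
    rw [h.supportDim_eq]
    exact_mod_cast Nat.lt_succ_self n
  have h4 : (n : ℕ∞) + 1 ≤ Order.coheight p := (add_le_add h1 le_rfl).trans h2
  rw [Nat.cast_add, Nat.cast_one] at h3
  exact absurd h4 (not_le.mpr h3)

theorem IsBaseChange.exists_quotSMulTop {R S M N : Type*} [CommRing R] [CommRing S] [Algebra R S]
    [AddCommGroup M] [Module R M] [AddCommGroup N] [Module R N] [Module S N] [IsScalarTower R S N]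
    {f : M →ₗ[R] N} (hf : IsBaseChange S f) (x : R) :
    ∃ g : QuotSMulTop x M →ₗ[R] QuotSMulTop (algebraMap R S x) N, IsBaseChange S g := by
  have e := (QuotSMulTop.algebraMapTensorEquivTensorQuotSMulTop x M S).symm ≪≫ₗ
    QuotSMulTop.congr (algebraMap R S x) hf.equiv
  exact ⟨e.toLinearMap.restrictScalars R ∘ₗ TensorProduct.mk R S (QuotSMulTop x M) 1,
    IsBaseChange.of_equiv e (fun _ ↦ by simp)⟩

theorem IsLocalizedModule.comap_mem_support {R S : Type*} [CommRing R] [CommRing S] [Algebra R S]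
    (T : Submonoid R) [IsLocalization T S] {M N : Type*} [AddCommGroup M] [Module R M]
    [AddCommGroup N] [Module R N] [Module S N] [IsScalarTower R S N] (f : M →ₗ[R] N)
    [IsLocalizedModule T f] {q : PrimeSpectrum S} (hq : q ∈ Module.support S N) :
    comap (algebraMap R S) q ∈ Module.support R M := by
  rw [Module.mem_support_iff_exists_annihilator] at hq ⊢
  obtain ⟨y, hy⟩ := hq
  obtain ⟨⟨m, s⟩, hms⟩ := IsLocalizedModule.surj T f y
  refine ⟨m, fun r hr => hy ?_⟩
  rw [Submodule.mem_annihilator_span_singleton] at hr ⊢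
  have h1 : s • (algebraMap R S r • y) = 0 := by
    rw [Submonoid.smul_def, algebraMap_smul, smul_comm, ← Submonoid.smul_def, hms, ← map_smul, hr,
      map_zero]
  exact IsLocalizedModule.smul_injective f s (h1.trans (smul_zero _).symm)

/-- Without a regular element, `p` lies in an associated prime, which is minimal in the support by
unmixedness. So `p` is the only prime of the support below `p`. -/
theorem IsCMOfDim.supportDim_localization_eq_zero {n : ℕ} (h : IsCMOfDim A n X) {B : Type*} [CommRing B]
    [IsLocalRing B] [Algebra A B] (p : Ideal A) [p.IsPrime] [IsLocalization.AtPrime B p]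
    {Y : Type*} [AddCommGroup Y] [Module A Y] [Module B Y] [IsScalarTower A B Y] [Nontrivial Y]
    {f : X →ₗ[A] Y} (hf : IsBaseChange B f)
    (hp : ¬ ∃ x ∈ p, IsSMulRegular X x) : Module.supportDim B Y = 0 := by
  have : IsNoetherianRing B := IsLocalization.isNoetherianRing p.primeCompl B ‹_›
  have : Module.Finite B Y := Module.Finite.equiv hf.equiv
  obtain ⟨q, hq, hpq⟩ : ∃ q ∈ associatedPrimes A X, p ≤ q := by
    by_contra! hcon
    exact hp (Ideal.exists_mem_isSMulRegular hcon)
  have : IsLocalizedModule p.primeCompl f := (isLocalizedModule_iff_isBaseChange _ B f).mpr hf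
  have key : Module.supportDim B Y < (1 : ℕ) := by
    refine Module.supportDim_lt_iff.mpr fun q' hq' => ?_
    have h1 := IsLocalizedModule.comap_mem_support p.primeCompl f hq'
    have h2 : comap (algebraMap A B) q' ≤ ⟨p, ‹_›⟩ := by
      rw [← PrimeSpectrum.asIdeal_le_asIdeal]
      change Ideal.comap _ _ ≤ p
      rw [← IsLocalization.AtPrime.under_maximalIdeal B p ‹_›]
      exact Ideal.comap_mono (IsLocalRing.le_maximalIdeal q'.isPrime.ne_top)
    have h3 := h.eq_of_le_of_mem_associatedPrimes (q := ⟨q, hq.isPrime⟩) hq h1 (h2.trans hpq)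
    have h4 : comap (algebraMap A B) q' = ⟨p, ‹_›⟩ := le_antisymm h2 (h3 ▸ hpq)
    have h5 : q' = closedPoint B := by
      refine PrimeSpectrum.localization_comap_injective B p.primeCompl ?_
      rw [h4]
      exact PrimeSpectrum.ext (IsLocalization.AtPrime.under_maximalIdeal B p ‹_›).symm
    have h6 : IsMax q' := by
      rw [h5]
      exact fun a _ => IsLocalRing.le_maximalIdeal a.isPrime.ne_top
    rw [Order.coheight_eq_zero.mpr h6]
    simp
  obtain ⟨e, he⟩ := WithBot.ne_bot_iff_exists.mp (Module.supportDim_ne_bot_of_nontrivial B Y)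
  change Module.supportDim B Y = 0
  rw [← he] at key ⊢
  have : e < 1 := by exact_mod_cast key
  rw [Order.lt_one_iff.mp this]
  rfl

/-- Cut by a regular element lying in `p`, which need not be the one supplied by the definition;
hence `IsCMOfDim.quotSMulTop`. When `p` has none, the localization has dimension zero. -/
theorem IsCMOfDim.localization {n : ℕ} (h : IsCMOfDim A n X) {B : Type*} [CommRing B]
    [IsLocalRing B] [Algebra A B] (p : Ideal A) [p.IsPrime] [IsLocalization.AtPrime B p]
    {Y : Type*} [AddCommGroup Y] [Module A Y] [Module B Y] [IsScalarTower A B Y] [Nontrivial Y]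
    {f : X →ₗ[A] Y} (hf : IsBaseChange B f) :
    ∃ k, IsCMOfDim B k Y := by
  have : IsNoetherianRing B := IsLocalization.isNoetherianRing p.primeCompl B ‹_›
  have : Module.Flat A B := IsLocalization.flat B p.primeCompl
  induction n generalizing X Y with
  | zero =>
    refine ⟨0, h.supportDim_localization_eq_zero p hf ?_⟩
    rintro ⟨x, hxp, hreg⟩
    have hxA : x ∈ maximalIdeal A := IsLocalRing.le_maximalIdeal (Ideal.IsPrime.ne_top ‹_›) hxp
    have h1 := Module.supportDim_quotSMulTop_succ_eq_supportDim hreg hxA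
    have := h.nontrivial
    have := nontrivial_quotSMulTop_of_mem_maximalIdeal X hxA
    obtain ⟨e, he⟩ := WithBot.ne_bot_iff_exists.mp
      (Module.supportDim_ne_bot_of_nontrivial A (QuotSMulTop x X))
    rw [h.supportDim_eq, ← he] at h1
    have h2 : e + 1 = 0 := by exact_mod_cast h1
    simp at h2
  | succ n ih =>
    by_cases hp : ∃ x ∈ p, IsSMulRegular X x
    · obtain ⟨x, hxp, hreg⟩ := hp
      have hxA : x ∈ maximalIdeal A := IsLocalRing.le_maximalIdeal (Ideal.IsPrime.ne_top ‹_›) hxp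
      have hxB : algebraMap A B x ∈ maximalIdeal B :=
        (IsLocalization.AtPrime.to_map_mem_maximal_iff B p x).mpr hxp
      have : Module.Finite B Y := Module.Finite.equiv hf.equiv
      have := nontrivial_quotSMulTop_of_mem_maximalIdeal Y hxB
      obtain ⟨g, hg⟩ := hf.exists_quotSMulTop x
      obtain ⟨k, hk⟩ := ih (h.quotSMulTop hxA hreg) hg
      exact ⟨k + 1, _, hxB, hreg.of_flat_of_isBaseChange hf, hk⟩
    · exact ⟨0, h.supportDim_localization_eq_zero p hf hp⟩

/-- The Cohen-Macaulay property passes from the localization at a prime to the localization at a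
smaller prime. -/
theorem IsCMOfDim.localization_of_le {R : Type*} [CommRing R] [IsNoetherianRing R] {M : Type*}
    [AddCommGroup M] [Module R M] [Module.Finite R M] {P m : Ideal R} [P.IsPrime] [m.IsPrime]
    (hle : P ≤ m) {A : Type*} [CommRing A] [IsLocalRing A] [Algebra R A]
    [IsLocalization.AtPrime A m] {X : Type*} [AddCommGroup X] [Module R X] [Module A X]
    [IsScalarTower R A X] (f : M →ₗ[R] X) [IsLocalizedModule m.primeCompl f]
    {B : Type*} [CommRing B] [IsLocalRing B] [Algebra R B]
    [IsLocalization.AtPrime B P] {Y : Type*} [AddCommGroup Y] [Module R Y] [Module B Y]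
    [IsScalarTower R B Y] (g : M →ₗ[R] Y) [IsLocalizedModule P.primeCompl g] [Nontrivial Y]
    {n : ℕ} (h : IsCMOfDim A n X) : ∃ k, IsCMOfDim B k Y := by
  have : IsNoetherianRing A := IsLocalization.isNoetherianRing m.primeCompl A ‹_›
  have hf : IsBaseChange A f := IsLocalizedModule.isBaseChange m.primeCompl A f
  have hg : IsBaseChange B g := IsLocalizedModule.isBaseChange P.primeCompl B g
  have : Module.Finite A X := Module.Finite.equiv hf.equiv
  have hcompl : m.primeCompl ≤ P.primeCompl := fun x hx hxP => hx (hle hxP)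
  let : Algebra A B := IsLocalization.localizationAlgebraOfSubmonoidLe A B m.primeCompl
    P.primeCompl hcompl
  have : IsScalarTower R A B :=
    IsLocalization.localization_isScalarTower_of_submonoid_le A B m.primeCompl P.primeCompl hcompl
  let : Module A Y := Module.compHom Y (algebraMap A B)
  have : IsScalarTower A B Y := ⟨fun a b y => by
    rw [Algebra.smul_def, mul_smul]; rfl⟩
  have : IsScalarTower R A Y := ⟨fun r a y => by
    change algebraMap A B (r • a) • y = r • (algebraMap A B a • y)
    rw [Algebra.smul_def, map_mul, mul_smul, ← IsScalarTower.algebraMap_apply, algebraMap_smul]⟩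
  let l : X →ₗ[A] Y := hf.lift g
  have hl : l.restrictScalars R ∘ₗ f = g := by
    ext x; exact hf.lift_eq g x
  have hbase : IsBaseChange B l := IsBaseChange.of_comp hf (by rw [hl]; exact hg)
  let p : Ideal A := (maximalIdeal B).under A
  have hpmem (a : R) : algebraMap R A a ∈ p ↔ a ∈ P := by
    rw [Ideal.mem_comap, ← IsScalarTower.algebraMap_apply,
      IsLocalization.AtPrime.to_map_mem_maximal_iff B P]
  have hloc := IsLocalization.isLocalization_of_submonoid_le A B m.primeCompl P.primeCompl hcompl
  have : IsLocalization.AtPrime B p := by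
    -- `B` inverts the image of `R ∖ P`; each element of `A ∖ p` divides its numerator, which is in
    -- that image.
    refine IsLocalization.of_le_of_exists_dvd (P.primeCompl.map (algebraMap R A)) _ ?_ ?_
    · rintro _ ⟨a, ha, rfl⟩ hap
      exact ha ((hpmem a).mp hap)
    · intro x hx
      obtain ⟨a, s, rfl⟩ := IsLocalization.exists_mk'_eq m.primeCompl x
      refine ⟨algebraMap R A a, ⟨a, fun ha => hx ?_, rfl⟩, algebraMap R A s, ?_⟩
      · rw [IsLocalization.mk'_eq_mul_mk'_one]
        exact p.mul_mem_right _ ((hpmem a).mpr ha)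
      · rw [IsLocalization.mk'_spec]
  exact h.localization p hbase

end Localization

/-! ### Cohen-Macaulay modules over Noetherian rings. -/

namespace SeqCM

section CohenMacaulay

variable {R : Type*} [CommRing R] [IsNoetherianRing R] {X : Type*} [AddCommGroup X] [Module R X]
  [Module.Finite R X]

/-- The definition tests maximal ideals only; `P` is reached through a maximal ideal containing it.
-/
theorem IsCohenMacaulay.exists_isCMOfDim (h : IsCohenMacaulay R X) (P : Ideal R) [P.IsPrime]
    {B : Type*} [CommRing B] [IsLocalRing B] [Algebra R B] [IsLocalization.AtPrime B P]
    {Y : Type*} [AddCommGroup Y] [Module R Y] [Module B Y] [IsScalarTower R B Y] (g : X →ₗ[R] Y)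
    [IsLocalizedModule P.primeCompl g] [Nontrivial Y] : ∃ k, IsCMOfDim B k Y := by
  obtain ⟨m, hm, hle⟩ := P.exists_le_maximal (Ideal.IsPrime.ne_top ‹_›)
  have hP : (⟨P, ‹_›⟩ : PrimeSpectrum R) ∈ Module.support R X := by
    rw [Module.mem_support_iff]
    exact (IsLocalizedModule.linearEquiv P.primeCompl
      (LocalizedModule.mkLinearMap P.primeCompl X) g).toEquiv.nontrivial
  have hmem : (⟨m, hm.isPrime⟩ : PrimeSpectrum R) ∈ Module.support R X :=
    Module.mem_support_mono hle hP
  have := Module.mem_support_iff.mp hmem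
  have h1 := h _ hm hmem
  have : IsNoetherianRing (Localization.AtPrime m) :=
    IsLocalization.isNoetherianRing m.primeCompl _ ‹_›
  have : Module.Finite (Localization.AtPrime m) (LocalizedModule m.primeCompl X) :=
    Module.Finite.of_isLocalizedModule m.primeCompl (LocalizedModule.mkLinearMap m.primeCompl X)
  obtain ⟨n, hn⟩ := depth_eq_supportDim_iff.mp h1
  exact hn.localization_of_le hle (LocalizedModule.mkLinearMap m.primeCompl X) g

theorem isCohenMacaulay_of_isCMOfDim [IsLocalRing R] {n : ℕ} (h : IsCMOfDim R n X) :
    IsCohenMacaulay R X := by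
  intro P _ hP
  have := Module.mem_support_iff.mp hP
  have : IsNoetherianRing (Localization.AtPrime P.asIdeal) :=
    IsLocalization.isNoetherianRing P.asIdeal.primeCompl _ ‹_›
  have : Module.Finite (Localization.AtPrime P.asIdeal)
      (LocalizedModule P.asIdeal.primeCompl X) :=
    Module.Finite.of_isLocalizedModule P.asIdeal.primeCompl
      (LocalizedModule.mkLinearMap P.asIdeal.primeCompl X)
  exact depth_eq_supportDim_iff.mpr <| h.localization P.asIdeal <|
    IsLocalizedModule.isBaseChange P.asIdeal.primeCompl _
      (LocalizedModule.mkLinearMap P.asIdeal.primeCompl X)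

theorem IsCohenMacaulay.exists_isCMOfDim_of_isLocalRing [IsLocalRing R] [Nontrivial X]
    (h : IsCohenMacaulay R X) : ∃ k, IsCMOfDim R k X := by
  have hunit (x : (maximalIdeal R).primeCompl) : IsUnit (x : R) :=
    not_not.mp fun hx => x.2 ((mem_maximalIdeal _).mpr hx)
  have : IsLocalization.AtPrime R (maximalIdeal R) :=
    IsLocalization.self fun x hx => hunit ⟨x, hx⟩
  have : IsLocalizedModule (maximalIdeal R).primeCompl (LinearMap.id : X →ₗ[R] X) :=
    (isLocalizedModule_iff_isBaseChange _ R _).mpr (IsBaseChange.ofEquiv (.refl R X))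
  exact h.exists_isCMOfDim (maximalIdeal R) (LinearMap.id : X →ₗ[R] X)

/-- The Cohen-Macaulay property passes to arbitrary localizations at primes. -/
theorem IsCohenMacaulay.of_isLocalizedModule (h : IsCohenMacaulay R X) (P : Ideal R) [P.IsPrime]
    {B : Type*} [CommRing B] [IsLocalRing B] [Algebra R B] [IsLocalization.AtPrime B P]
    {Y : Type*} [AddCommGroup Y] [Module R Y] [Module B Y] [IsScalarTower R B Y] (g : X →ₗ[R] Y)
    [IsLocalizedModule P.primeCompl g] : IsCohenMacaulay B Y := by
  rcases subsingleton_or_nontrivial Y with _ | _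
  · exact isCohenMacaulay_of_subsingleton
  have : IsNoetherianRing B := IsLocalization.isNoetherianRing P.primeCompl _ ‹_›
  have : Module.Finite B Y := Module.Finite.of_isLocalizedModule P.primeCompl g (Rₚ := B)
  obtain ⟨k, hk⟩ := h.exists_isCMOfDim P (B := B) g
  exact isCohenMacaulay_of_isCMOfDim hk

/-- Transfers the property between two models of the same localization: a quotient of submodules of
`M_P` and the localization of a quotient. -/
theorem depth_eq_supportDim_of_isLocalizedModule (P : Ideal R) [P.IsPrime]
    {B : Type*} [CommRing B] [IsLocalRing B] [Algebra R B] [IsLocalization.AtPrime B P]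
    {Y : Type*} [AddCommGroup Y] [Module R Y] [Module B Y] [IsScalarTower R B Y] (g : X →ₗ[R] Y)
    [IsLocalizedModule P.primeCompl g] (h : IsCohenMacaulay B Y)
    {A : Type*} [CommRing A] [IsLocalRing A] [Algebra R A] [IsLocalization.AtPrime A P]
    {Z : Type*} [AddCommGroup Z] [Module R Z] [Module A Z] [IsScalarTower R A Z] (f : X →ₗ[R] Z)
    [IsLocalizedModule P.primeCompl f] [Nontrivial Z] :
    (depth A Z : WithBot ℕ∞) = Module.supportDim A Z := by
  have : IsNoetherianRing B := IsLocalization.isNoetherianRing P.primeCompl _ ‹_›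
  have : IsNoetherianRing A := IsLocalization.isNoetherianRing P.primeCompl _ ‹_›
  have : Module.Finite B Y := Module.Finite.of_isLocalizedModule P.primeCompl g (Rₚ := B)
  have : Module.Finite A Z := Module.Finite.of_isLocalizedModule P.primeCompl f
  have : Nontrivial Y := (IsLocalizedModule.linearEquiv P.primeCompl g f).toEquiv.nontrivial
  obtain ⟨n, hn⟩ := h.exists_isCMOfDim_of_isLocalRing
  exact depth_eq_supportDim_iff.mpr (hn.localization_of_le (P := P) (m := P) le_rfl g f)

end CohenMacaulay

end SeqCM

/-! ### Finite dimension and the equivalence. -/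

theorem PrimeSpectrum.exists_forall_coheight_lt_of_finiteType (k : Type*) [Field k] {R : Type*} [CommRing R]
    [Algebra k R] [Algebra.FiniteType k R] :
    ∃ d : ℕ, ∀ p : PrimeSpectrum R, Order.coheight p < d := by
  obtain ⟨n, f, hf⟩ := Algebra.FiniteType.iff_quotient_mvPolynomial''.mp
    (inferInstance : Algebra.FiniteType k R)
  refine ⟨n + 1, fun p => ?_⟩
  have h1 := Order.coheight_le_krullDim p
  have h2 : ringKrullDim R ≤ (n : WithBot ℕ∞) := by
    refine (ringKrullDim_le_of_surjective f.toRingHom hf).trans ?_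
    rw [MvPolynomial.ringKrullDim_of_isNoetherianRing]
    simp
  have h3 : Order.coheight p ≤ (n : ℕ∞) := by
    have := h1.trans h2
    exact_mod_cast this
  exact h3.trans_lt (by exact_mod_cast Nat.lt_succ_self n)

theorem PrimeSpectrum.coheight_localization_le (k : Type*) [Field k] {R : Type*} [CommRing R]
    [Algebra k R] [Algebra.FiniteType k R]
    (P : PrimeSpectrum R)
    (q : PrimeSpectrum (Localization.AtPrime P.asIdeal)) :
    Order.coheight q ≤
      Order.coheight (PrimeSpectrum.comap (algebraMap R (Localization.AtPrime P.asIdeal)) q) := by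
  rw [PrimeSpectrum.coheight_comap_eq_add k]
  exact le_self_add

theorem exists_isLocalizedModule_dimLT_quotient (k : Type*) [Field k] {R : Type*} [CommRing R]
    [Algebra k R] [Algebra.FiniteType k R]
    {M : Type*} [AddCommGroup M] [Module R M] (P : PrimeSpectrum R) {t : ℕ}
    (ht : Order.coheight P = t) (n : ℕ) :
    ∃ g : (dimLT R M (n + 1 + t) ⧸ (dimLT R M (n + t)).submoduleOf (dimLT R M (n + 1 + t))) →ₗ[R]
      (dimLT (Localization.AtPrime P.asIdeal) (LocalizedModule P.asIdeal.primeCompl M) (n + 1) ⧸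
        (dimLT (Localization.AtPrime P.asIdeal)
          (LocalizedModule P.asIdeal.primeCompl M) n).submoduleOf
        (dimLT (Localization.AtPrime P.asIdeal)
          (LocalizedModule P.asIdeal.primeCompl M) (n + 1))),
      IsLocalizedModule P.asIdeal.primeCompl g := by
  have h := exists_isLocalizedModule_quotient_submoduleOf (Localization.AtPrime P.asIdeal)
    P.asIdeal.primeCompl (LocalizedModule.mkLinearMap P.asIdeal.primeCompl M)
    (dimLT R M (n + t)) (dimLT R M (n + 1 + t))
  rwa [localized'_dimLT k P ht, localized'_dimLT k P ht] at h

end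

theorem corollary2p1 (k : Type*) [Field k] (R : Type*) [CommRing R] [Algebra k R]
    [Algebra.FiniteType k R] (M : Type*) [AddCommGroup M] [Module R M] [Module.Finite R M]
    [Nontrivial M] :
    SeqCM.IsSequentiallyCohenMacaulay R M ↔
      ∀ P : PrimeSpectrum R, P ∈ Module.support R M →
        SeqCM.IsSequentiallyCohenMacaulay (Localization.AtPrime P.asIdeal)
          (LocalizedModule P.asIdeal.primeCompl M) := by
  have : IsNoetherianRing R := Algebra.FiniteType.isNoetherianRing k R
  obtain ⟨d, hd⟩ := PrimeSpectrum.exists_forall_coheight_lt_of_finiteType (R := R) k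
  have hloc (P : PrimeSpectrum R) : SeqCM.IsSequentiallyCohenMacaulay
      (Localization.AtPrime P.asIdeal) (LocalizedModule P.asIdeal.primeCompl M) ↔ _ :=
    have : IsNoetherianRing (Localization.AtPrime P.asIdeal) :=
      IsLocalization.isNoetherianRing P.asIdeal.primeCompl _ ‹_›
    have : Module.Finite (Localization.AtPrime P.asIdeal)
        (LocalizedModule P.asIdeal.primeCompl M) :=
      Module.Finite.of_isLocalizedModule P.asIdeal.primeCompl
        (LocalizedModule.mkLinearMap P.asIdeal.primeCompl M)
    SeqCM.isSequentiallyCohenMacaulay_iff_dimLT (d := d) fun q =>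
      (PrimeSpectrum.coheight_localization_le k P q).trans_lt (hd _)
  rw [SeqCM.isSequentiallyCohenMacaulay_iff_dimLT hd]
  simp only [hloc]
  constructor
  · intro h P _ n
    obtain ⟨t, ht⟩ : ∃ t : ℕ, Order.coheight P = t :=
      ⟨_, (ENat.natCast_toNat (PrimeSpectrum.coheight_lt_top_of_finiteType k P).ne).symm⟩
    obtain ⟨g, hg⟩ := exists_isLocalizedModule_dimLT_quotient k (M := M) P ht n
    have h1 := h (n + t)
    rw [Nat.add_right_comm n t 1] at h1
    exact h1.of_isLocalizedModule P.asIdeal g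
  · intro h n P hmax hP
    -- At a maximal ideal the index is not shifted, so each quotient of `M` is tested by the
    -- quotient of `M_P` with the same `n`.
    have ht : Order.coheight P = (0 : ℕ) := by
      rw [Nat.cast_zero, Order.coheight_eq_zero]
      exact fun q hq => (hmax.eq_of_le q.isPrime.ne_top hq).ge
    have hPM : P ∈ Module.support R M :=
      Module.support_subset_of_injective (dimLT R M (n + 1)).subtype Subtype.val_injective <|
        Module.support_subset_of_surjective _ (Submodule.mkQ_surjective _) hP
    obtain ⟨g, hg⟩ := exists_isLocalizedModule_dimLT_quotient k (M := M) P ht n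
    have := Module.mem_support_iff.mp hP
    exact SeqCM.depth_eq_supportDim_of_isLocalizedModule P.asIdeal g (h P hPM n)
      (LocalizedModule.mkLinearMap P.asIdeal.primeCompl _)
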